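/- Let $n\ge 1$ be odd and let $q\ge 2$ be even. Write $\mathbf 1=11\cdots1\in\mathbb Z_q^n$, and define the Lee distance of $v,w\in\mathbb Z_q^n$ (letters represented by $0,\dots,q-1$) by $\sum_{k=1}^n\min\{|v_k-w_k|,\,q-|v_k-w_k|\}$. For $S\subseteq\mathbb Z_q^n$, a quasi-complementary Lee metric Gray code of $q$-ary $n$-tuples missing exactly $S$ is an ordering $G(0),\dots,G(N-1)$, without repetition, of the $N=q^n-|S|$ words of $\mathbb Z_q^n\setminus S$ such that any two consecutive words $G(i),G(i+1)$ ($0\le i<N-1$) have Lee distance $1$, and $$G\bigl((i+\lfloor N/q\rfloor)\bmod N\bigr)=G(i)+\mathbf 1\qquad(0\le i<N).$$ (a) For every $w\in\mathbb Z_q^n$ there is a quasi-complementary Lee metric Gray code of $q$-ary $n$-tuples missing exactly the $q$ words $w+ii\cdots i$, $0\le i<q$. (It has length $N=q^n-q$ and shift $N/q=q^{n-1}-1$; for $n=1$ it is empty.) (b) If $n>1$, this number of missing words is the least possible: every quasi-complementary Lee metric Gray code of $q$-ary $n$-tuples missing exactly $S$ has $|S|\ge q$. -/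

import Mathlib

/-- Words of length `n` over the alphabet `ℤ/q`. Addition is coordinatewise, and the word `1` is
the constant word `11⋯1`. -/
abbrev Word (q n : ℕ) : Type := Fin n → ZMod q

/-- The Lee distance `∑ min (|vᵢ - wᵢ|, q - |vᵢ - wᵢ|)`, where the letters are represented by
integers in `{0, …, q - 1}`. -/
def leeDist {q n : ℕ} (v w : Word q n) : ℕ :=
  ∑ i, min (((v i).val : ℤ) - ((w i).val : ℤ)).natAbs
    (q - (((v i).val : ℤ) - ((w i).val : ℤ)).natAbs)

/-- The words `w + ii⋯i` for the letters `i` of the alphabet. -/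
def constantTranslates {q n : ℕ} (w : Word q n) : Set (Word q n) :=
  {v | ∃ i : ZMod q, v = w + fun _ => i}

/-- `G(0), …, G(N - 1)` is a quasi-complementary Lee metric Gray code of `q`-ary `n`-tuples
missing exactly the words of `S`: an ordering, without repetition, of the words outside `S` such
that consecutive words are at Lee distance one, and such that moving on cyclically by one `q`-th of
the length of the code adds `11⋯1`. For `S = ∅` the length is `q ^ n` and the shift is
`q ^ (n - 1)`. -/
structure IsQuasiComplementaryLeeGrayCode {q n N : ℕ} (S : Set (Word q n))
    (G : Fin N → Word q n) : Prop where
  injective : Function.Injective G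
  range_eq : Set.range G = Sᶜ
  leeDist_succ : ∀ (i : ℕ) (h : i + 1 < N),
    leeDist (G ⟨i, Nat.lt_of_succ_lt h⟩) (G ⟨i + 1, h⟩) = 1
  shift : ∀ i : Fin N, G ⟨((i : ℕ) + N / q) % N, Nat.mod_lt _ i.pos⟩ = G i + 1

/-! Existence. Every word lies in exactly one coset of the constant words, and each coset has one
representative `w + (0, u)` with `u` of even length `n - 1`; the coset to be missed is `u = 0`.
Suppose the torus of words `u ≠ 0` has a Hamiltonian path from some `x` to `x + 1`. Following it in
the last `n - 1` letters, and repeating it translated by each constant word `j⋯j`, gives the code: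
passing from block `j` to block `j + 1` keeps the tail `x + 1 + j` and raises only the first letter
(`exists_code_of_list`).

Such a path is built by induction, two letters at a time (`exists_hamPath_compl_zero`). The base is
an explicit path in the punctured two-dimensional torus. The step `HamPath.prod_step` combines the
old path, whose start `x` is a neighbour of the missing vertex, with a Hamiltonian cycle of the
two-dimensional torus through `(0,0), (0,1), (1,1)`. The new path runs from `(x, (0,0))` to `(x + 1,
(1,1))`.

Minimality. Shifting `q` times returns to the start, which forces `q ∣ N` and hence `q ∣ |S|`. So
`|S| < q` would mean `S = ∅` and a shift `q ^ (n - 1)`, which is even. Steps of Lee distance one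
flip the parity of the letter sum, so an even shift preserves it, whereas adding `1` changes it by
the odd number `n`. -/

open Set

/-! ### Hamiltonian paths of a relation -/

/-- `HamPath r A x y`: the elements of `A` can be listed without repetition, from `x` to `y`, with
consecutive elements related by `r`. -/
inductive HamPath {V : Type*} (r : V → V → Prop) : Set V → V → V → Prop
  | single (x : V) : HamPath r {x} x x
  | cons {A : Set V} {x y z : V} (hxy : r x y) (hx : x ∉ A) (h : HamPath r A y z) :
      HamPath r (insert x A) x z

namespace HamPath

variable {V W : Type*} {r : V → V → Prop} {s : W → W → Prop} {A B : Set V} {x y z w : V}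

theorem copy (h : HamPath r A x y) (hA : A = B) : HamPath r B x y := hA ▸ h

theorem append (h : HamPath r A x y) (hyz : r y z) (hAB : Disjoint A B)
    (h' : HamPath r B z w) : HamPath r (A ∪ B) x w := by
  induction h with
  | single x =>
    exact (cons hyz (by simpa using hAB) h').copy (by ext; simp)
  | @cons A a b c hab ha _ ih =>
    rw [Set.disjoint_insert_left] at hAB
    exact (cons hab (by simp [ha, hAB.1]) (ih hyz hAB.2)).copy (by rw [Set.insert_union])

theorem reverse (hr : Std.Symm r) (h : HamPath r A x y) : HamPath r A y x := by
  induction h with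
  | single x => exact single x
  | @cons A a b c hab ha _ ih =>
    exact (ih.append (hr.symm _ _ hab) (by simpa using ha) (single a)).copy (by ext; simp)

theorem map {f : V → W} (hf : Function.Injective f) (hrs : ∀ a b, r a b → s (f a) (f b))
    (h : HamPath r A x y) : HamPath s (f '' A) (f x) (f y) := by
  induction h with
  | single x => exact (single (f x)).copy (by simp)
  | @cons A a b c hab ha _ ih =>
    exact (cons (hrs _ _ hab) (by simpa [hf.eq_iff] using ha) ih).copy (by rw [Set.image_insert_eq])

theorem exists_list (h : HamPath r A x y) :
    ∃ l : List V, l.IsChain r ∧ l.Nodup ∧ (∀ v, v ∈ l ↔ v ∈ A) ∧ l.head? = some x ∧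
      l.getLast? = some y := by
  induction h with
  | single x => exact ⟨[x], by simp⟩
  | @cons A a b c hab ha _ ih =>
    obtain ⟨l, h1, h2, h3, h4, h5⟩ := ih
    refine ⟨a :: l, ?_, ?_, ?_, rfl, ?_⟩
    · rw [List.isChain_cons]
      refine ⟨fun y hy => ?_, h1⟩
      rw [h4] at hy
      simp only [Option.mem_def, Option.some.injEq] at hy
      exact hy ▸ hab
    · exact List.nodup_cons.2 ⟨fun h => ha ((h3 a).1 h), h2⟩
    · intro v; simp [h3]
    · rw [List.getLast?_cons, h5]; rfl

end HamPath

/-! ### Hamiltonian paths in box products -/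

/-- Adjacency in the box product of two relations. -/
def Box {V W : Type*} (r : V → V → Prop) (s : W → W → Prop) (a b : V × W) : Prop :=
  (r a.1 b.1 ∧ a.2 = b.2) ∨ (a.1 = b.1 ∧ s a.2 b.2)

section Box

variable {V W : Type*} {r : V → V → Prop} {s : W → W → Prop}

theorem Box.symmetric (hr : Std.Symm r) (hs : Std.Symm s) : Std.Symm (Box r s) := by
  constructor
  rintro a b (⟨h, h'⟩ | ⟨h, h'⟩)
  · exact Or.inl ⟨hr.symm _ _ h, h'.symm⟩
  · exact Or.inr ⟨h.symm, hs.symm _ _ h'⟩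

theorem HamPath.column {C : Set W} {c d : W} (h : HamPath s C c d) (v : V) :
    HamPath (Box r s) ({v} ×ˢ C) (v, c) (v, d) :=
  (h.map (f := fun w => (v, w)) (fun _ _ h => by simpa using h)
    (fun _ _ h => Or.inr ⟨rfl, h⟩)).copy (by rw [Set.singleton_prod])

theorem HamPath.row {B : Set V} {x y : V} (h : HamPath r B x y) (w : W) :
    HamPath (Box r s) (B ×ˢ {w}) (x, w) (y, w) :=
  (h.map (f := fun v => (v, w)) (fun _ _ h => by simpa using h)
    (fun _ _ h => Or.inl ⟨h, rfl⟩)).copy (by rw [Set.prod_singleton])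

/-- Boustrophedon: the columns over `B` are traversed alternately forwards and backwards, so the
parity of their number decides at which end of `C` the path stops. -/
theorem HamPath.snake [Finite V] (hs : Std.Symm s) {B : Set V} {x y : V} (h : HamPath r B x y) :
    ∀ {C : Set W} {c d : W}, HamPath s C c d →
      (Even B.ncard → HamPath (Box r s) (B ×ˢ C) (x, c) (y, c)) ∧
      (Odd B.ncard → HamPath (Box r s) (B ×ˢ C) (x, c) (y, d)) := by
  induction h with
  | single x =>
    intro C c d hC
    exact ⟨fun h => by simp at h, fun _ => hC.column x⟩
  | @cons A a b e hab ha _ ih =>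
    intro C c d hC
    have hA : (insert a A).ncard = A.ncard + 1 := Set.ncard_insert_of_notMem ha (Set.toFinite A)
    have key : ∀ f : W, HamPath (Box r s) (A ×ˢ C) (b, d) (e, f) →
        HamPath (Box r s) ((insert a A) ×ˢ C) (a, c) (e, f) := by
      intro f hf
      refine ((hC.column a).append (z := (b, d)) (Or.inl ⟨hab, rfl⟩) ?_ hf).copy ?_
      · exact Set.disjoint_left.2 fun p hp hp' => ha (hp.1 ▸ hp'.1)
      · rw [← Set.union_prod, Set.singleton_union]
    have ih' := ih (hC.reverse hs)
    rw [hA, Nat.even_add_one, Nat.not_even_iff_odd, Nat.odd_add_one, Nat.not_odd_iff_even]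
    exact ⟨fun h => key _ (ih'.2 h), fun h => key _ (ih'.1 h)⟩

/-- The cycle `w₀ → w₁ → w₂ ⇝ w₃ → w₀` covers `W`. The path takes `(x, w₀), (x, w₁)`, crosses to
column `o` and runs it from `w₁` to `w₃`, returns to column `x` and runs it from `w₃` back to `w₂`.
The remaining columns are even in number, so a snake that enters them at `w₂` also leaves at `w₂`.
-/
theorem HamPath.prod_step [Finite V] (hV : Even (Nat.card V)) (hr : Std.Symm r) (hs : Std.Symm s)
    {o x y : V} (h : HamPath r {o}ᶜ x y) (hxo : r x o) (hxy : x ≠ y)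
    {w₀ w₁ w₂ w₃ : W} (hw : HamPath s {w₀, w₁}ᶜ w₂ w₃) (h₀₁ : s w₀ w₁) (h₁₂ : s w₁ w₂)
    (h₃₀ : s w₃ w₀) (hne : w₀ ≠ w₁) :
    HamPath (Box r s) {(o, w₀)}ᶜ (x, w₀) (y, w₂) := by
  have hfull : HamPath s univ w₂ w₁ :=
    (hw.append h₃₀ (by simp [Set.disjoint_left])
      (cons h₀₁ (by simpa using hne) (single w₁))).copy (by ext v; simp; tauto)
  have hw' : HamPath s {w₀}ᶜ w₁ w₃ :=
    (cons h₁₂ (by simp) hw).copy (by ext v; simp; grind)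
  -- Splits off the first vertex `x`; the rest of the path starts at a neighbour `b` of `x` and
  -- covers `{o, x}ᶜ`.
  generalize hD : ({o}ᶜ : Set V) = D at h
  cases h with
  | single => exact absurd rfl hxy
  | @cons A _ b _ hxb hxA hA =>
    have hox : o ≠ x := by
      rintro rfl
      have : o ∈ ({o}ᶜ : Set V) := hD ▸ Set.mem_insert _ _
      simp at this
    have hAeq : A = {o, x}ᶜ := by
      ext v
      have := Set.ext_iff.1 hD v
      simp only [Set.mem_compl_iff, Set.mem_singleton_iff, Set.mem_insert_iff] at this ⊢
      grind
    have hcard : Even A.ncard := by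
      have h1 := Set.ncard_add_ncard_compl ({o, x} : Set V)
      rw [Set.ncard_pair hox, ← hAeq] at h1
      rw [← h1, Nat.even_add] at hV
      exact hV.1 even_two
    have h1 : HamPath (Box r s) {(x, w₀), (x, w₁)} (x, w₀) (x, w₁) :=
      cons (y := (x, w₁)) (Or.inr ⟨rfl, h₀₁⟩) (by simpa using hne) (single _)
    have h2 := h1.append (z := (o, w₁)) (Or.inl ⟨hxo, rfl⟩)
      (by simp [Set.disjoint_left, hox.symm]) (hw'.column o)
    have h3 := h2.append (z := (x, w₃)) (Or.inl ⟨hr.symm _ _ hxo, rfl⟩)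
      (by rw [Set.disjoint_left]; rintro ⟨a, b⟩; simp; grind) ((hw.reverse hs).column x)
    have h4 := h3.append (z := (b, w₂)) (Or.inl ⟨hxb, rfl⟩)
      (by rw [Set.disjoint_left, hAeq]; rintro ⟨a, b⟩; simp; grind) ((hA.snake hs hfull).1 hcard)
    refine h4.copy ?_
    rw [hAeq]
    ext ⟨a, b⟩
    simp
    grind

end Box

/-! ### The cycle and the two-dimensional torus -/

/-- Adjacency in the cycle of residues modulo `q`. -/
def CycAdj {q : ℕ} (a b : ZMod q) : Prop := b = a + 1 ∨ a = b + 1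

section Cycle

variable {q : ℕ}

theorem CycAdj.symmetric : Std.Symm (CycAdj (q := q)) := ⟨fun _ _ h => h.symm⟩

theorem hamPath_natCast (k : ℕ) : ∀ d, k + d < q →
    HamPath CycAdj {a : ZMod q | ∃ i, k ≤ i ∧ i ≤ k + d ∧ a = (i : ZMod q)} (k : ZMod q)
      ((k + d : ℕ) : ZMod q) := by
  intro d
  induction d with
  | zero =>
    intro _
    refine (HamPath.single _).copy ?_
    ext a
    simp only [Set.mem_singleton_iff, Set.mem_ofPred_eq]
    constructor
    · rintro rfl; exact ⟨k, by simp⟩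
    · rintro ⟨i, h1, h2, rfl⟩
      congr 1; omega
  | succ d ih =>
    intro h
    refine ((ih (by omega)).append (z := ((k + (d + 1) : ℕ) : ZMod q)) (Or.inl (by push_cast; ring))
      ?_ (HamPath.single _)).copy ?_
    · rw [Set.disjoint_singleton_right]
      rintro ⟨i, h1, h2, h3⟩
      rw [ZMod.natCast_eq_natCast_iff'] at h3
      rw [Nat.mod_eq_of_lt h, Nat.mod_eq_of_lt (by omega)] at h3
      omega
    · ext a
      simp only [Set.mem_union, Set.mem_singleton_iff, Set.mem_ofPred_eq]
      constructor
      · rintro (⟨i, h1, h2, rfl⟩ | rfl)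
        · exact ⟨i, h1, by omega, rfl⟩
        · exact ⟨k + (d + 1), by omega, le_rfl, rfl⟩
      · rintro ⟨i, h1, h2, rfl⟩
        rcases Nat.lt_or_ge i (k + (d + 1)) with h | h
        · exact Or.inl ⟨i, h1, by omega, rfl⟩
        · right; congr 1; omega

theorem natCast_pred_eq_neg_one (hq : 0 < q) : ((q - 1 : ℕ) : ZMod q) = -1 := by
  rw [Nat.cast_sub hq]; simp

theorem hamPath_natCast_neg_one {k : ℕ} (hk : k < q) :
    HamPath CycAdj {a : ZMod q | k ≤ a.val} (k : ZMod q) (-1) := by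
  have : NeZero q := ⟨by omega⟩
  have h := hamPath_natCast (q := q) k (q - 1 - k) (by omega)
  rw [show k + (q - 1 - k) = q - 1 by omega, natCast_pred_eq_neg_one (by omega)] at h
  refine h.copy ?_
  ext a
  simp only [Set.mem_ofPred_eq]
  constructor
  · rintro ⟨i, h1, h2, rfl⟩
    rwa [ZMod.val_natCast, Nat.mod_eq_of_lt (by omega)]
  · intro h
    exact ⟨a.val, h, by have := a.val_lt; omega, by simp⟩

theorem hamPath_univ (hq : 0 < q) : HamPath CycAdj (univ : Set (ZMod q)) 0 (-1) := by
  simpa using hamPath_natCast_neg_one hq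

theorem hamPath_compl_zero (hq : 1 < q) : HamPath CycAdj ({0}ᶜ : Set (ZMod q)) 1 (-1) := by
  have := hamPath_natCast_neg_one hq
  rw [Nat.cast_one] at this
  refine this.copy ?_
  ext a
  simp [Nat.one_le_iff_ne_zero]

theorem hamPath_compl_pair (hq : 2 < q) : HamPath CycAdj ({0, 1}ᶜ : Set (ZMod q)) 2 (-1) := by
  have := hamPath_natCast_neg_one hq
  rw [Nat.cast_two] at this
  refine this.copy ?_
  have : Fact (1 < q) := ⟨by omega⟩
  have h1 : (1 : ZMod q).val = 1 := ZMod.val_one q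
  ext a
  simp only [Set.mem_ofPred_eq, Set.mem_compl_iff, Set.mem_insert_iff, Set.mem_singleton_iff,
    ← (ZMod.val_injective q).eq_iff, h1, ZMod.val_zero]
  omega

theorem ncard_compl_zero (hq : 0 < q) : ({0}ᶜ : Set (ZMod q)).ncard = q - 1 := by
  have : NeZero q := ⟨by omega⟩
  rw [Set.ncard_compl, Set.ncard_singleton, Nat.card_zmod]

/-- Column `0` is run down from `(0, -1)` to `(0, 1)`; a snake covers the `q - 1` (odd) other
columns off row `0`, from `(1, 1)` to `(-1, -1)`; row `0` is run back from `(-1, 0)` to `(1, 0)`.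
The endpoints differ by `(1, 1)`. -/
theorem hamPath_torus_compl_zero (hq : Even q) (hq0 : 0 < q) :
    HamPath (Box CycAdj CycAdj) ({(0, 0)}ᶜ : Set (ZMod q × ZMod q)) (0, -1) (1, 0) := by
  have hq1 : 1 < q := by obtain ⟨k, rfl⟩ := hq; omega
  have : NeZero q := ⟨by omega⟩
  have hodd : Odd ({0}ᶜ : Set (ZMod q)).ncard := by
    rw [ncard_compl_zero hq0]; exact Nat.Even.sub_odd hq0 hq odd_one
  have h := hamPath_compl_zero hq1
  have hrev := h.reverse CycAdj.symmetric
  have h1 := (hrev.column (r := CycAdj) (0 : ZMod q)).append (z := (1, 1))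
    (Or.inl ⟨Or.inl (by simp), rfl⟩) (by rw [Set.disjoint_left]; rintro ⟨a, b⟩; simp; grind)
    ((h.snake CycAdj.symmetric h).2 hodd)
  have h2 := h1.append (z := (-1, 0))
    (Or.inr ⟨rfl, Or.inl (by simp)⟩) (by rw [Set.disjoint_left]; rintro ⟨a, b⟩; simp; grind)
    (hrev.row (s := CycAdj) (0 : ZMod q))
  refine h2.copy ?_
  ext ⟨a, b⟩
  simp
  grind

/-- Closed up through `(0, 0), (0, 1)`, this is the Hamiltonian cycle needed by `HamPath.prod_step`.
Row `1` is run from `1` to `-1`, the `q - 2` (even) full rows `2, …, q - 1` are snaked starting and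
ending at `-1`, and row `0` is run back to `1`. -/
theorem hamPath_torus_compl_pair (hq : Even q) (hq0 : 0 < q) :
    HamPath (Box CycAdj CycAdj) ({(0, 0), (0, 1)}ᶜ : Set (ZMod q × ZMod q)) (1, 1) (1, 0) := by
  have hq1 : 1 < q := by obtain ⟨k, rfl⟩ := hq; omega
  have : NeZero q := ⟨by omega⟩
  have : Fact (1 < q) := ⟨hq1⟩
  have h := hamPath_compl_zero hq1
  have hrev := h.reverse CycAdj.symmetric
  have h01 : (0 : ZMod q) ≠ 1 := zero_ne_one
  rcases Nat.lt_or_ge 2 q with hq2 | hq2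
  · have heven : Even ({0, 1}ᶜ : Set (ZMod q)).ncard := by
      rw [Set.ncard_compl, Set.ncard_pair h01, Nat.card_zmod]
      exact hq.tsub even_two
    have h1 := ((hamPath_compl_pair hq2).snake CycAdj.symmetric
      ((hamPath_univ hq0).reverse CycAdj.symmetric)).1 heven
    have h2 := h1.map (f := Prod.swap) (s := Box CycAdj CycAdj) Prod.swap_injective
      (by rintro a b (⟨h, h'⟩ | ⟨h, h'⟩)
          exacts [Or.inr ⟨h', h⟩, Or.inl ⟨h', h⟩])
    have h3 := (h.row (s := CycAdj) (1 : ZMod q)).append (z := (-1, 2))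
      (Or.inr ⟨rfl, Or.inl (by norm_num)⟩)
      (by rw [Set.disjoint_left, Set.image_swap_prod]; rintro ⟨a, b⟩; simp; grind) h2
    have h4 := h3.append (z := (-1, 0)) (Or.inr ⟨rfl, Or.inl (by simp)⟩)
      (by rw [Set.disjoint_left, Set.image_swap_prod]; rintro ⟨a, b⟩; simp; grind)
      (hrev.row (s := CycAdj) (0 : ZMod q))
    refine h4.copy ?_
    rw [Set.image_swap_prod]
    ext ⟨a, b⟩
    simp
    grind
  -- No full rows remain: only `(1, 1)` and `(1, 0)` are left.
  · obtain rfl : q = 2 := by omega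
    exact (HamPath.cons (y := (1, 0)) (Or.inr ⟨rfl, Or.inl (by decide)⟩) (by decide)
      (HamPath.single _)).copy (by ext ⟨a, b⟩; revert a b; decide)

end Cycle

/-! ### Words, Lee distance and the punctured torus -/

/-- Two words are adjacent in the torus if they differ by one in exactly one letter. -/
def WordAdj {q n : ℕ} (v w : Word q n) : Prop :=
  ∃ i, CycAdj (v i) (w i) ∧ ∀ j ≠ i, v j = w j

theorem one_lt_of_even_of_pos {q : ℕ} (hq : Even q) (hq0 : 0 < q) : 1 < q := by
  obtain ⟨k, rfl⟩ := hq; omega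

section Word

variable {q n : ℕ}

theorem lee_add_one (hq : 1 < q) (a : ZMod q) :
    min ((((a + 1).val : ℤ) - (a.val : ℤ)).natAbs)
      (q - (((a + 1).val : ℤ) - (a.val : ℤ)).natAbs) = 1 := by
  have : Fact (1 < q) := ⟨hq⟩
  have : NeZero q := ⟨by omega⟩
  have h1 : (1 : ZMod q).val = 1 := ZMod.val_one q
  have ha := a.val_lt
  rcases Nat.lt_or_ge (a.val + 1) q with h | h
  · rw [ZMod.val_add_of_lt (by rwa [h1]), h1]
    omega
  · have : (a + 1).val = 0 := by
      rw [ZMod.val_add, h1, show a.val + 1 = q by omega, Nat.mod_self]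
    rw [this]
    omega

theorem leeDist_comm (v w : Word q n) : leeDist v w = leeDist w v :=
  Finset.sum_congr rfl fun i _ => by
    rw [← Int.natAbs_neg, neg_sub]

theorem leeDist_eq_one_of_adj (hq : 1 < q) {v w : Word q n} (h : WordAdj v w) :
    leeDist v w = 1 := by
  have key : ∀ {v w : Word q n} (i : Fin n), v i = w i + 1 → (∀ j ≠ i, v j = w j) →
      leeDist v w = 1 := by
    intro v w i hi hj
    rw [leeDist, Finset.sum_eq_single i (fun j _ h => by simp [hj j h]) (by simp), hi,
      lee_add_one hq]
  obtain ⟨i, h | h, hj⟩ := h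
  · rw [leeDist_comm]
    exact key i h fun j hji => (hj j hji).symm
  · exact key i h hj

theorem WordAdj.add_left {v w : Word q n} (h : WordAdj v w) (u : Word q n) :
    WordAdj (u + v) (u + w) := by
  obtain ⟨i, h, hj⟩ := h
  refine ⟨i, ?_, fun j hji => by simp [hj j hji]⟩
  rcases h with h | h
  · left; simp [h, add_assoc]
  · right; simp [h, add_assoc]

theorem WordAdj.cons {v w : Word q n} (h : WordAdj v w) (a : ZMod q) :
    WordAdj (Fin.cons a v : Word q (n + 1)) (Fin.cons a w) := by
  obtain ⟨i, h, hj⟩ := h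
  refine ⟨i.succ, by simpa using h, fun j hji => ?_⟩
  cases j using Fin.cases with
  | zero => rfl
  | succ j => simpa using hj j (by simpa using hji)

theorem WordAdj.cons_head {a b : ZMod q} (h : CycAdj a b) (v : Word q n) :
    WordAdj (Fin.cons a v : Word q (n + 1)) (Fin.cons b v) := by
  refine ⟨0, by simpa using h, fun j hj => ?_⟩
  cases j using Fin.cases with
  | zero => exact absurd rfl hj
  | succ j => simp

theorem WordAdj.symmetric : Std.Symm (WordAdj (q := q) (n := n)) :=
  ⟨fun _ _ ⟨i, h, hj⟩ => ⟨i, h.symm, fun j hji => (hj j hji).symm⟩⟩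

/-- Prefixing two letters to a word. -/
def consTwo (p : Word q n × (ZMod q × ZMod q)) : Word q (n + 2) :=
  Fin.cons p.2.1 (Fin.cons p.2.2 p.1 : Word q (n + 1))

theorem consTwo_injective : Function.Injective (consTwo (q := q) (n := n)) := by
  rintro ⟨v, a, b⟩ ⟨w, c, d⟩ h
  obtain ⟨h1, h2⟩ := Fin.cons_injective2 h
  obtain ⟨h3, h4⟩ := Fin.cons_injective2 h2
  simp_all

theorem consTwo_surjective : Function.Surjective (consTwo (q := q) (n := n)) := fun v =>
  ⟨(Fin.tail (Fin.tail v), (v 0, Fin.tail v 0)), by simp [consTwo, Fin.cons_self_tail]⟩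

theorem consTwo_adj {p p' : Word q n × (ZMod q × ZMod q)}
    (h : Box WordAdj (Box CycAdj CycAdj) p p') : WordAdj (consTwo p) (consTwo p') := by
  obtain ⟨v, a, b⟩ := p
  obtain ⟨w, c, d⟩ := p'
  rcases h with ⟨h, h'⟩ | ⟨h, h'⟩
  · cases h'
    exact (h.cons _).cons _
  · cases h
    rcases h' with ⟨h1, h2⟩ | ⟨h1, h2⟩
    · cases h2
      exact WordAdj.cons_head h1 _
    · cases h1
      exact (WordAdj.cons_head h2 _).cons _

theorem consTwo_zero : consTwo ((0 : Word q n), ((0 : ZMod q), (0 : ZMod q))) = 0 := by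
  funext j
  cases j using Fin.cases with
  | zero => rfl
  | succ j => cases j using Fin.cases <;> rfl

theorem consTwo_add_one (v : Word q n) (a b : ZMod q) :
    consTwo (v + 1, (a + 1, b + 1)) = consTwo (v, (a, b)) + 1 := by
  funext j
  cases j using Fin.cases with
  | zero => rfl
  | succ j => cases j using Fin.cases <;> rfl

theorem HamPath.consTwo {v w : Word q n × (ZMod q × ZMod q)}
    (h : HamPath (Box WordAdj (Box CycAdj CycAdj)) {(0, (0, 0))}ᶜ v w) :
    HamPath WordAdj {0}ᶜ (consTwo v) (consTwo w) := by
  refine (h.map consTwo_injective fun _ _ => consTwo_adj).copy ?_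
  rw [Set.image_compl_eq ⟨consTwo_injective, consTwo_surjective⟩, Set.image_singleton,
    consTwo_zero]

/-- For even `q` and even positive length, the torus without the word `0` has a Hamiltonian path
from a neighbour `x` of `0` to `x + 1`. -/
theorem exists_hamPath_compl_zero (hq : Even q) (hq0 : 0 < q) (k : ℕ) :
    ∃ x : Word q (2 * k + 2), WordAdj x 0 ∧ HamPath WordAdj {0}ᶜ x (x + 1) := by
  have hq1 := one_lt_of_even_of_pos hq hq0
  have : NeZero q := ⟨by omega⟩
  have : Fact (1 < q) := ⟨hq1⟩
  induction k with
  | zero =>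
    -- The endpoint of the explicit path is `(1, 0) = (0, -1) + 1`.
    refine ⟨_root_.consTwo ((0 : Word q 0), (0, -1)), ?_, ?_⟩
    · rw [← consTwo_zero]
      exact consTwo_adj (Or.inr ⟨rfl, Or.inr ⟨rfl, Or.inl (by simp)⟩⟩)
    · have h := ((hamPath_torus_compl_zero hq hq0).column (r := WordAdj) (0 : Word q 0)).copy
        (B := {(0, (0, 0))}ᶜ) (by
          ext ⟨v, a, b⟩
          simp [Subsingleton.elim v 0])
      rw [← consTwo_add_one]
      simpa using h.consTwo
  | succ k ih =>
    obtain ⟨x, hx0, hx⟩ := ih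
    refine ⟨_root_.consTwo (x, (0, 0)), ?_, ?_⟩
    · rw [← consTwo_zero]
      exact consTwo_adj (Or.inl ⟨hx0, rfl⟩)
    · rw [← consTwo_add_one]
      have hcard : Even (Nat.card (Word q (2 * k + 2))) := by
        rw [Nat.card_fun, Nat.card_zmod, Nat.card_fin]
        exact hq.pow_of_ne_zero (by omega)
      have hne : x ≠ x + 1 := fun h => by
        have := congrFun h 0
        simp at this
      -- Here `w₀, w₁, w₂, w₃` are `(0,0), (0,1), (1,1), (1,0)`; `w₂ = w₀ + 1` makes the new
      -- endpoints differ by `1`.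
      have h := hx.prod_step hcard WordAdj.symmetric
        (Box.symmetric CycAdj.symmetric CycAdj.symmetric) hx0 hne
        (hamPath_torus_compl_pair hq hq0) (Or.inr ⟨rfl, Or.inl (by simp)⟩)
        (Or.inl ⟨Or.inl (by simp), rfl⟩) (Or.inl ⟨Or.inr (by simp), rfl⟩) (by simp)
      simpa using h.consTwo

/-! ### From a Hamiltonian path to a code -/

theorem exists_code_of_list {m : ℕ} (hq : 1 < q) (w : Word q (m + 1)) {x : Word q m}
    (hx : HamPath WordAdj {0}ᶜ x (x + 1)) :
    ∃ G : Fin (q ^ (m + 1) - q) → Word q (m + 1),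
      IsQuasiComplementaryLeeGrayCode (constantTranslates w) G := by
  have : NeZero q := ⟨by omega⟩
  obtain ⟨l, hchain, hnodup, hmem, hhead, hlast⟩ := hx.exists_list
  set M := l.length with hM
  have hlen : M + 1 = q ^ m := by
    have h1 : l.toFinset = {0}ᶜ := by ext v; simp [hmem]
    have h2 := List.toFinset_card_of_nodup hnodup
    rw [h1, Finset.card_compl, Finset.card_singleton] at h2
    simp only [Fintype.card_fun, ZMod.card, Fintype.card_fin] at h2
    have : 0 < q ^ m := by positivity
    omega
  have hN : q ^ (m + 1) - q = M * q := by
    rw [pow_succ, ← hlen, Nat.add_mul, one_mul, Nat.add_sub_cancel]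
  have hMpos : 0 < M := by
    rw [hM, List.length_pos_iff]
    rintro rfl
    simp at hhead
  have hheadM : l[0]'hMpos = x := by
    rw [List.head?_eq_getElem?, List.getElem?_eq_getElem hMpos] at hhead
    simpa using hhead
  have hlastM : l[M - 1]'(by omega) = x + 1 := by
    rw [List.getLast?_eq_getElem?, List.getElem?_eq_getElem (by omega)] at hlast
    simpa using hlast
  rw [hN]
  -- Index `k = M * j + i` is position `i` in block `j`, the translate by `j⋯j`.
  let g : ℕ → Word q (m + 1) := fun k =>
    w + (Fin.cons (0 : ZMod q) (l[k % M]'(Nat.mod_lt _ hMpos)) + fun _ => ((k / M : ℕ) : ZMod q))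
  have hg : ∀ (j i : ℕ) (hi : i < M), g (M * j + i) =
      w + (Fin.cons (0 : ZMod q) (l[i]) + fun _ => (j : ZMod q)) := by
    intro j i hi
    have h1 : (M * j + i) % M = i := by rw [Nat.mul_add_mod, Nat.mod_eq_of_lt hi]
    have h2 : (M * j + i) / M = j := by
      rw [Nat.mul_add_div hMpos, Nat.div_eq_of_lt hi, add_zero]
    simp only [g, h1, h2]
  have hdecomp : ∀ k, ∃ j i, i < M ∧ k = M * j + i := fun k =>
    ⟨k / M, k % M, Nat.mod_lt _ hMpos, (Nat.div_add_mod k M).symm⟩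
  have hltq : ∀ {j i}, M * j + i < M * q → j < q := fun {j i} h =>
    lt_of_mul_lt_mul_left (lt_of_le_of_lt (Nat.le_add_right _ i) h) (Nat.zero_le _)
  refine ⟨fun k => g k, ?_, ?_, ?_, ?_⟩
  · rintro ⟨k, hk⟩ ⟨k', hk'⟩ h
    obtain ⟨j, i, hi, rfl⟩ := hdecomp k
    obtain ⟨j', i', hi', rfl⟩ := hdecomp k'
    simp only [hg _ _ hi, hg _ _ hi', add_right_inj] at h
    have h0 : (j : ZMod q) = j' := by simpa using congrFun h 0
    rw [h0, add_left_inj] at h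
    have h1 := hnodup.getElem_inj_iff.1 (Fin.cons_injective2 h).2
    rw [ZMod.natCast_eq_natCast_iff', Nat.mod_eq_of_lt (hltq hk), Nat.mod_eq_of_lt (hltq hk')] at h0
    subst h0 h1
    rfl
  · ext v
    simp only [Set.mem_range, Set.mem_compl_iff, constantTranslates, Set.mem_ofPred_eq]
    constructor
    · rintro ⟨⟨k, hk⟩, rfl⟩ ⟨a, ha⟩
      obtain ⟨j, i, hi, rfl⟩ := hdecomp k
      simp only [hg _ _ hi, add_right_inj] at ha
      have h0 : (j : ZMod q) = a := by simpa using congrFun ha 0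
      subst h0
      have h1 := (hmem l[i]).1 (List.getElem_mem hi)
      apply h1
      funext t
      simpa using congrFun ha t.succ
    · intro hv
      -- The tail of `v - w` after subtracting the constant word that clears its first letter; `u =
      -- 0` exactly when `v` is a missing word.
      let u : Word q m := fun t => v t.succ - w t.succ - (v 0 - w 0)
      have hu : u ∈ l := by
        rw [hmem]
        intro hu0
        refine hv ⟨v 0 - w 0, ?_⟩
        funext t
        cases t using Fin.cases with
        | zero => simp
        | succ t =>
          have : v t.succ - w t.succ - (v 0 - w 0) = 0 := congrFun hu0 t
          simp only [Pi.add_apply]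
          linear_combination this
      obtain ⟨i, hi, hiu⟩ := List.getElem_of_mem hu
      have hj := (v 0 - w 0).val_lt
      refine ⟨⟨M * (v 0 - w 0).val + i, ?_⟩, ?_⟩
      · calc M * (v 0 - w 0).val + i < M * (v 0 - w 0).val + M := by omega
          _ = M * ((v 0 - w 0).val + 1) := by ring
          _ ≤ M * q := Nat.mul_le_mul_left _ hj
      · simp only [hg _ _ hi, hiu]
        funext t
        cases t using Fin.cases with
        | zero => simp
        | succ t => simp [u]
  · intro k hk
    apply leeDist_eq_one_of_adj hq
    obtain ⟨j, i, hi, rfl⟩ := hdecomp k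
    change WordAdj (g (M * j + i)) (g (M * j + i + 1))
    rcases Nat.lt_or_ge (i + 1) M with h | h
    · rw [add_assoc, hg _ _ hi, hg _ _ h]
      apply WordAdj.add_left
      rw [add_comm _ (fun _ => (j : ZMod q)), add_comm _ (fun _ => (j : ZMod q))]
      apply WordAdj.add_left
      apply WordAdj.cons
      exact List.isChain_iff_getElem.1 hchain i h
    -- Block boundary: the tails `(x + 1) + j` and `x + (j + 1)` agree, so only the first letter
    -- moves.
    · obtain rfl : i = M - 1 := by omega
      have e : M * j + (M - 1) + 1 = M * (j + 1) + 0 := by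
        rw [Nat.mul_add]; omega
      rw [e, hg _ _ hi, hg _ _ hMpos, hlastM, hheadM]
      apply WordAdj.add_left
      refine ⟨0, Or.inl (by simp), fun t ht => ?_⟩
      cases t using Fin.cases with
      | zero => exact absurd rfl ht
      | succ t => simp [add_comm, add_left_comm]
  · rintro ⟨k, hk⟩
    obtain ⟨j, i, hi, rfl⟩ := hdecomp k
    have hjq := hltq hk
    change g ((M * j + i + M * q / q) % (M * q)) = g (M * j + i) + 1
    rw [Nat.mul_div_cancel _ (by omega), hg _ _ hi]
    have e : M * j + i + M = M * (j + 1) + i := by ring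
    rw [e]
    rcases Nat.lt_or_ge (j + 1) q with h | h
    · rw [Nat.mod_eq_of_lt, hg _ _ hi]
      · funext t
        simp [add_assoc]
      · calc M * (j + 1) + i < M * (j + 1) + M := by omega
          _ = M * (j + 1 + 1) := by ring
          _ ≤ M * q := Nat.mul_le_mul_left _ h
    -- Last block: the index wraps to block `0`, and `j + 1 = 0` in `ZMod q`.
    · obtain rfl : q = j + 1 := by omega
      have e' : (M * (j + 1) + i) % (M * (j + 1)) = M * 0 + i := by
        rw [Nat.add_mod_left, Nat.mod_eq_of_lt, mul_zero, zero_add]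
        exact lt_of_lt_of_le hi (Nat.le_mul_of_pos_right _ (by omega))
      rw [e', hg _ _ hi]
      have hz : (j : ZMod (j + 1)) + 1 = 0 := by exact_mod_cast ZMod.natCast_self (j + 1)
      funext t
      simp [add_assoc, hz]

/-! ### Parity and the lower bound -/

/-- The sum of the letters modulo two; only meaningful for even `q`. -/
def wordParity (h : 2 ∣ q) (v : Word q n) : ZMod 2 := ∑ i, ZMod.castHom h (ZMod 2) (v i)

theorem wordParity_add_one (h : 2 ∣ q) (v : Word q n) :
    wordParity h (v + 1) = wordParity h v + n := by
  simp only [wordParity, Pi.add_apply, Pi.one_apply, map_add, map_one, Finset.sum_add_distrib]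
  simp

/-- For even `q`, both `d` and `q - d` have the parity of `d = |a - b|`, which is that of `a + b`.
-/
theorem natCast_lee (h : 2 ∣ q) (hq0 : 0 < q) (a b : ZMod q) :
    ((min ((a.val : ℤ) - (b.val : ℤ)).natAbs (q - ((a.val : ℤ) - (b.val : ℤ)).natAbs) : ℕ) :
      ZMod 2) = ZMod.castHom h (ZMod 2) a + ZMod.castHom h (ZMod 2) b := by
  have : NeZero q := ⟨by omega⟩
  have ha := a.val_lt
  have hb := b.val_lt
  have e : ∀ c : ZMod q, ZMod.castHom h (ZMod 2) c = (c.val : ZMod 2) := fun c => by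
    rw [ZMod.castHom_apply, ZMod.cast_eq_val]
  rw [e, e, ← Nat.cast_add, ZMod.natCast_eq_natCast_iff']
  omega

theorem natCast_leeDist (h : 2 ∣ q) (hq0 : 0 < q) (v w : Word q n) :
    (leeDist v w : ZMod 2) = wordParity h v + wordParity h w := by
  rw [leeDist, Nat.cast_sum, wordParity, wordParity, ← Finset.sum_add_distrib]
  exact Finset.sum_congr rfl fun i _ => natCast_lee h hq0 _ _

theorem card_missing_ge (hn : Odd n) (hq : Even q) (hq0 : 0 < q) (hn1 : 1 < n)
    (S : Set (Word q n)) (N : ℕ) (G : Fin N → Word q n)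
    (hG : IsQuasiComplementaryLeeGrayCode S G) : q ≤ S.ncard := by
  have hq1 := one_lt_of_even_of_pos hq hq0
  have : NeZero q := ⟨by omega⟩
  have : Fact (1 < q) := ⟨hq1⟩
  by_contra! hlt
  have hcard : S.ncard + N = q ^ n := by
    have h1 := Set.ncard_add_ncard_compl S
    rw [← hG.range_eq, Set.ncard_range_of_injective hG.injective] at h1
    simpa [Nat.card_fun] using h1
  have hqn : q ≤ q ^ n := Nat.le_self_pow (by omega) q
  have hN : 0 < N := by omega
  have hiter : ∀ k : ℕ, G ⟨(k * (N / q)) % N, Nat.mod_lt _ hN⟩ =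
      G ⟨0, hN⟩ + fun _ => (k : ZMod q) := by
    intro k
    induction k with
    | zero => ext; simp
    | succ k ih =>
      have h := hG.shift ⟨(k * (N / q)) % N, Nat.mod_lt _ hN⟩
      rw [ih] at h
      simp only [Nat.mod_add_mod, ← Nat.succ_mul] at h
      refine h.trans ?_
      funext t
      simp [add_assoc]
  -- A zero shift would give `G 0 = G 0 + 1`.
  have hMpos : 0 < N / q := by
    by_contra! h0
    have h := hiter 1
    simp only [Nat.le_zero.1 h0, mul_zero, Nat.zero_mod] at h
    have := congrFun h ⟨0, by omega⟩
    simp at this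
  -- After `q` shifts the word is `G 0` again, so injectivity gives `N ∣ q * (N / q)`, a positive
  -- number at most `N`.
  have hMq : q * (N / q) = N := by
    have h := hiter q
    have h' : G ⟨(q * (N / q)) % N, Nat.mod_lt _ hN⟩ = G ⟨0, hN⟩ := by
      rw [h]; funext t; simp
    have h2 := congrArg Fin.val (hG.injective h')
    exact le_antisymm (Nat.mul_div_le N q)
      (Nat.le_of_dvd (by positivity) (Nat.dvd_of_mod_eq_zero h2))
  have hdvd : q ∣ S.ncard := by
    rw [← Nat.dvd_add_left (Dvd.intro _ hMq), hcard]
    exact dvd_pow_self q (by omega)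
  have hS : S.ncard = 0 := Nat.eq_zero_of_dvd_of_lt hdvd hlt
  rw [hS, zero_add] at hcard
  -- The shift is `q ^ (n - 1)`, with positive exponent because `1 < n`.
  have hMeven : Even (N / q) := by
    rw [hcard, ← Nat.pow_sub_one hq0.ne' (by omega)]
    exact hq.pow_of_ne_zero (by omega)
  have hpar : ∀ (i : ℕ) (h : i < N), wordParity hq.two_dvd (G ⟨i, h⟩) =
      wordParity hq.two_dvd (G ⟨0, hN⟩) + i := by
    intro i
    induction i with
    | zero => simp
    | succ i ih =>
      intro h
      have h1 := natCast_leeDist hq.two_dvd hq0 (G ⟨i, by omega⟩) (G ⟨i + 1, h⟩)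
      rw [hG.leeDist_succ i h, ih (by omega)] at h1
      push_cast at h1 ⊢
      clear ih
      generalize wordParity hq.two_dvd (G ⟨0, hN⟩) = a at *
      generalize wordParity hq.two_dvd (G ⟨i + 1, h⟩) = b at *
      generalize (i : ZMod 2) = c at *
      revert a b c
      decide
  have hMN : N / q < N := Nat.div_lt_self hN hq1
  have h1 := hpar _ hMN
  have h2 := hG.shift ⟨0, hN⟩
  simp only [zero_add, Nat.mod_eq_of_lt hMN] at h2
  rw [h2, wordParity_add_one, add_right_inj, (ZMod.natCast_eq_zero_iff_even).2 hMeven,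
    ZMod.natCast_eq_zero_iff_even] at h1
  exact Nat.not_even_iff_odd.2 hn h1

end Word

theorem mainTheorem4 (n q : ℕ) (hn : Odd n) (hq : Even q) (hq0 : 0 < q) :
    (∀ w : Word q n, ∃ G : Fin (q ^ n - q) → Word q n,
      IsQuasiComplementaryLeeGrayCode (constantTranslates w) G) ∧
    (1 < n → ∀ (S : Set (Word q n)) (N : ℕ) (G : Fin N → Word q n),
      IsQuasiComplementaryLeeGrayCode S G → q ≤ S.ncard) := by
  refine ⟨fun w => ?_, card_missing_ge hn hq hq0⟩
  obtain ⟨k, rfl⟩ := hn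
  cases k with
  | zero =>
    -- For `n = 1` the constant translates of `w` are all the words.
    have h0 : q ^ (2 * 0 + 1) - q = 0 := by simp
    rw [h0]
    refine ⟨Fin.elim0, fun i => i.elim0, ?_, fun i h => by omega, fun i => i.elim0⟩
    rw [Set.range_eq_empty, eq_comm, Set.compl_empty_iff, Set.eq_univ_iff_forall]
    intro v
    refine ⟨v 0 - w 0, ?_⟩
    funext i
    obtain rfl : i = 0 := Fin.fin_one_eq_zero i
    simp
  | succ k =>
    obtain ⟨x, -, hx⟩ := exists_hamPath_compl_zero hq hq0 k
    exact exists_code_of_list (one_lt_of_even_of_pos hq hq0) w hx
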